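/- Let $n \ge 4$, $[n]=\{1,\dots,n\}$, and let $\mathfrak S_n$ be the symmetric group of $[n]$. Let $R=\mathbb R[y_{1,2},\dots,y_{n,n-1},z]$ be the polynomial ring in indeterminates $y_{i,j}$ ($i,j\in[n]$, $i\ne j$) and $z$, and let $K$ be its field of fractions. For $\sigma\in\mathfrak S_n$ put $$\mathrm{inv}_y(\sigma)=\sum_{\substack{i<j\\ \sigma(i)>\sigma(j)}}y_{i,j},\qquad \mathrm{fix}_z(\sigma)=\#\{i\in[n] : \sigma(i)=i\}\,z ,$$ and let $\mathsf{IF}(n)=\big(\mathrm{inv}_y(\sigma\tau^{-1})+\mathrm{fix}_z(\sigma\tau^{-1})\big)_{\sigma,\tau\in\mathfrak S_n}$, an $n!\times n!$ matrix over $R$, where $(\sigma\tau^{-1})(i)=\sigma(\tau^{-1}(i))$. Then $\mathsf{IF}(n)$ is diagonalizable over $K$, and its spectrum consists of exactly the following five pairwise distinct elements of $R$, with the stated multiplicities (sums over $1\le i<j\le n$): - $\displaystyle \frac{n!}{2}\sum_{i<j}y_{i,j}+n!\,z$, with multiplicity $1$; - $\displaystyle (n-2)!\,\Big(nz-\sum_{i<j}(j-i)\,y_{i,j}\Big)$,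 with multiplicity $n-1$; - $\displaystyle -(n-3)!\sum_{i<j}\big(n-2(j-i)\big)\,y_{i,j}$, with multiplicity $\binom{n-1}{2}$; - $\displaystyle n\,(n-2)!\,z$, with multiplicity $(n-1)(n-2)$; - $0$, with multiplicity $\displaystyle n!-\frac n2(3n-7)-3$. -/

import Mathlib

open scoped Nat

noncomputable section

namespace PermStat

/-- The indeterminates: `y_{i,j}` for ordered pairs of distinct `i, j`, and one further
indeterminate `z`. The set `[n]` is modelled by `Fin n`. -/
abbrev Vars (n : ℕ) : Type := {p : Fin n × Fin n // p.1 ≠ p.2} ⊕ Unit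

/-- The polynomial ring `ℝ[y_{1,2}, …, y_{n,n-1}, z]`. -/
abbrev Poly (n : ℕ) : Type := MvPolynomial (Vars n) ℝ

/-- The indeterminate `y_{i,j}` for `i ≠ j`. The value at `i = j` is a dummy that is never used:
below `y i j` only occurs with `i < j`. -/
def y {n : ℕ} (i j : Fin n) : Poly n :=
  if h : i ≠ j then MvPolynomial.X (Sum.inl ⟨(i, j), h⟩) else 0

/-- The indeterminate `z`. -/
def z {n : ℕ} : Poly n := MvPolynomial.X (Sum.inr ())

/-- The pairs `(i, j)` with `i < j`. -/
def pairs (n : ℕ) : Finset (Fin n × Fin n) :=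
  Finset.univ.filter fun p => p.1 < p.2

/-- The inversion set of a permutation. -/
def Inv {n : ℕ} (σ : Equiv.Perm (Fin n)) : Finset (Fin n × Fin n) :=
  Finset.univ.filter fun p => p.1 < p.2 ∧ σ p.1 > σ p.2

/-- The set of fixed points of a permutation. -/
def Fix {n : ℕ} (σ : Equiv.Perm (Fin n)) : Finset (Fin n) :=
  Finset.univ.filter fun i => σ i = i

/-- The multinomial inversion statistic. -/
def invY {n : ℕ} (σ : Equiv.Perm (Fin n)) : Poly n :=
  ∑ p ∈ Inv σ, y p.1 p.2

/-- The fixed point statistic. -/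
def fixZ {n : ℕ} (σ : Equiv.Perm (Fin n)) : Poly n :=
  ((Fix σ).card : Poly n) * z

/-- The matrix `IF(n)`, with rows and columns indexed by the permutations. -/
def IF (n : ℕ) : Matrix (Equiv.Perm (Fin n)) (Equiv.Perm (Fin n)) (Poly n) :=
  Matrix.of fun σ τ => invY (σ * τ⁻¹) + fixZ (σ * τ⁻¹)

/-- The field of fractions `ℝ(y_{1,2}, …, y_{n,n-1}, z)`. -/
abbrev Frac (n : ℕ) : Type := FractionRing (Poly n)

/-- The inclusion of polynomials in the field of rational functions. -/
abbrev toFrac (n : ℕ) : Poly n →+* Frac n := algebraMap (Poly n) (Frac n)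

/-- `IF(n)` as a matrix over the field of rational functions. -/
def IFfrac (n : ℕ) : Matrix (Equiv.Perm (Fin n)) (Equiv.Perm (Fin n)) (Frac n) :=
  (IF n).map (toFrac n)

/-- A square matrix over a field is diagonalizable if it is similar to a diagonal matrix. -/
def Diagonalizable {ι K : Type*} [Fintype ι] [DecidableEq ι] [Field K]
    (M : Matrix ι ι K) : Prop :=
  ∃ P : Matrix ι ι K, IsUnit P ∧ ∃ d : ι → K, P⁻¹ * M * P = Matrix.diagonal d

/-- The multiplicity of `a` as an eigenvalue of `M`, that is, as a root of the characteristic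
polynomial. For a diagonalizable matrix it is also the dimension of the eigenspace. -/
def eigenMult {ι K : Type*} [Fintype ι] [DecidableEq ι] [Field K]
    (M : Matrix ι ι K) (a : K) : ℕ :=
  M.charpoly.rootMultiplicity a

/-- `(n!/2) ∑_{i<j} y_{i,j} + n! z`. -/
def ev₁ (n : ℕ) : Poly n :=
  MvPolynomial.C ((n ! : ℝ) / 2) * ∑ p ∈ pairs n, y p.1 p.2 + MvPolynomial.C (n ! : ℝ) * z

/-- `(n-2)! n z - (n-2)! ∑_{i<j} (j-i) y_{i,j}`. -/
def ev₂ (n : ℕ) : Poly n :=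
  MvPolynomial.C (((n - 2)! : ℝ) * n) * z -
    MvPolynomial.C ((n - 2)! : ℝ) *
      ∑ p ∈ pairs n, MvPolynomial.C ((p.2.val : ℝ) - (p.1.val : ℝ)) * y p.1 p.2

/-- `-(n-3)! ∑_{i<j} (n - 2(j-i)) y_{i,j}`. -/
def ev₃ (n : ℕ) : Poly n :=
  -(MvPolynomial.C ((n - 3)! : ℝ) *
    ∑ p ∈ pairs n,
      MvPolynomial.C ((n : ℝ) - 2 * ((p.2.val : ℝ) - (p.1.val : ℝ))) * y p.1 p.2)

/-- `(n-2)! n z`. -/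
def ev₄ (n : ℕ) : Poly n := MvPolynomial.C (((n - 2)! : ℝ) * n) * z

end PermStat

end

/-!
For `f = inv_y + fix_z`, the matrix `IF(n)` acts on functions on the symmetric group by
`(M v)(σ) = ∑ ρ, f ρ * v (ρ⁻¹ σ)`. Up to the constant `1/2`, the indicator of an inversion is half
the sign of `σ i - σ j`, so every value of `M` is a combination of constants, of functions `g (σ k)`
of one position, and of signs `sg (σ k) (σ l)`. On these functions `M` is triangular:

* constants are eigenvectors for `ev₁`;
* `M` multiplies the centred position `pos (σ k)` by `ev₂` (`sum_stat_mul_pos`);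
* `M` multiplies `g (σ k)` by `ev₄`, up to a constant and a multiple of `pos (σ k)`
  (`sum_stat_mul_inv_apply`);
* `M` multiplies `sg (σ k) (σ l)` by `ev₃`, up to a multiple of `pos (σ k) - pos (σ l)`
  (`sum_stat_mul_sg`).

These formulas come from averages over the permutations with one or two prescribed values. They say
that `(M - ev₁) (M - ev₂) (M - ev₄) (M - ev₃) M = 0` (`aeval_statMatrix_eq_zero`), and since the
five roots are distinct, `M` is diagonalizable. The same triangular form shows that `ev₁` is simple.
The trace of `M` is `n! n z`. Comparing its coefficients at `z`, `y_{1,2}` and `y_{1,3}` with those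
of the sum of the eigenvalues gives the multiplicities of `ev₂`, `ev₃` and `ev₄`
(`multiplicities_of_trace`), and the dimension `n!` gives that of `0`.
-/

namespace PermStat

/-! ### Diagonalization by a polynomial with simple roots -/

open Polynomial in
/-- The eigenvectors of `M` span the space: Lagrange interpolation at the points of `s` writes
every vector as a sum of eigenvectors. -/
theorem span_eigenvectors_eq_top {ι K : Type*} [Fintype ι] [DecidableEq ι] [Field K]
    (M : Matrix ι ι K) (s : Finset K) (hs : s.Nonempty)
    (h : aeval M.mulVecLin (∏ a ∈ s, (X - C a)) = 0) :
    Submodule.span K {v : ι → K | ∃ a ∈ s, M.mulVec v = a • v} = ⊤ := by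
  classical
  rw [eq_top_iff]
  intro v _
  have h1 : aeval M.mulVecLin (∑ a ∈ s, Lagrange.basis s id a) v = v := by
    rw [Lagrange.sum_basis (Function.injective_id.injOn) hs]
    simp
  rw [← h1, map_sum, LinearMap.sum_apply]
  refine Submodule.sum_mem _ fun a ha => Submodule.subset_span ⟨a, ha, ?_⟩
  have h2 : (X - C a) * Lagrange.basis s id a
      = C (∏ j ∈ s.erase a, (a - j)⁻¹) * ∏ j ∈ s, (X - C j) := by
    rw [Lagrange.basis, ← Finset.mul_prod_erase s _ ha, map_prod]
    simp only [Lagrange.basisDivisor, Finset.prod_mul_distrib, id]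
    ring
  have h3 := congrArg (fun p => aeval M.mulVecLin p v) h2
  simp only [map_mul, h, mul_zero, Module.End.mul_apply, LinearMap.zero_apply, map_sub, aeval_X,
    aeval_C, LinearMap.sub_apply, Module.algebraMap_end_apply, Matrix.mulVecLin_apply] at h3
  exact sub_eq_zero.mp h3

open Polynomial in
/-- A matrix annihilated by a product of distinct linear factors is similar to a diagonal matrix
whose entries are among the roots. -/
theorem exists_conj_diagonal {ι K : Type*} [Fintype ι] [DecidableEq ι] [Field K]
    (M : Matrix ι ι K) (s : Finset K) (hs : s.Nonempty)
    (h : aeval M.mulVecLin (∏ a ∈ s, (X - C a)) = 0) :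
    ∃ P : Matrix ι ι K, IsUnit P ∧ ∃ d : ι → K, (∀ i, d i ∈ s) ∧
      P⁻¹ * M * P = Matrix.diagonal d := by
  obtain ⟨b, hb, hspan, hli⟩ :=
    exists_linearIndependent K {v : ι → K | ∃ a ∈ s, M.mulVec v = a • v}
  rw [span_eigenvectors_eq_top M s hs h] at hspan
  let B := Module.Basis.mk hli (by simp [hspan])
  let e : b ≃ ι := B.indexEquiv (Pi.basisFun K ι)
  let B' := B.reindex e
  have hB' : ∀ i, ∃ a ∈ s, M.mulVec (B' i) = a • B' i := by
    intro i
    have : B' i = ((e.symm i : b) : ι → K) := by simp [B', B]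
    rw [this]
    exact hb (e.symm i).2
  choose d hd hMd using hB'
  let P : Matrix ι ι K := (Pi.basisFun K ι).toMatrix B'
  have hP : IsUnit P := by
    have := (Pi.basisFun K ι).invertibleToMatrix B'
    exact isUnit_of_invertible P
  refine ⟨P, hP, d, hd, ?_⟩
  have hMP : M * P = P * Matrix.diagonal d := by
    ext i j
    have := congrFun (hMd j) i
    rw [Matrix.mul_diagonal, Matrix.mul_apply]
    simpa [Matrix.mulVec, dotProduct, P, Module.Basis.toMatrix_apply, mul_comm] using this
  rw [mul_assoc, hMP, ← mul_assoc, Matrix.nonsing_inv_mul _ ((Matrix.isUnit_iff_isUnit_det _).mp hP),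
    one_mul]

section Conj

variable {ι K : Type*} [Fintype ι] [DecidableEq ι] [Field K] {M P : Matrix ι ι K} {d : ι → K}

theorem charpoly_of_conj_diagonal (hP : IsUnit P) (h : P⁻¹ * M * P = Matrix.diagonal d) :
    M.charpoly = ∏ i, (Polynomial.X - Polynomial.C (d i)) := by
  rw [← Matrix.charpoly_diagonal, ← h]
  obtain ⟨u, rfl⟩ := hP
  exact (Matrix.charpoly_units_conj' u M).symm

theorem eigenMult_of_conj_diagonal [DecidableEq K] (hP : IsUnit P)
    (h : P⁻¹ * M * P = Matrix.diagonal d) (a : K) :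
    eigenMult M a = (Finset.univ.filter fun i => d i = a).card := by
  rw [eigenMult, charpoly_of_conj_diagonal hP h, ← Polynomial.count_roots,
    Polynomial.roots_prod _ _ (Finset.prod_ne_zero_iff.mpr fun i _ => Polynomial.X_sub_C_ne_zero _)]
  simp only [Polynomial.roots_X_sub_C, Multiset.bind_singleton, Multiset.count_map]
  simp only [eq_comm (a := a)]
  rfl

theorem spectrum_of_conj_diagonal (hP : IsUnit P)
    (h : P⁻¹ * M * P = Matrix.diagonal d) : spectrum K M = Set.range d := by
  ext a
  rw [Matrix.mem_spectrum_iff_isRoot_charpoly, charpoly_of_conj_diagonal hP h, Polynomial.IsRoot,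
    Polynomial.eval_prod, Finset.prod_eq_zero_iff]
  simp [sub_eq_zero, eq_comm]

theorem trace_of_conj_diagonal (hP : IsUnit P) (h : P⁻¹ * M * P = Matrix.diagonal d) :
    M.trace = ∑ i, d i := by
  rw [← Matrix.trace_diagonal, ← h, Matrix.trace_conj' hP]

/-- A diagonal entry occurs once if the eigenvectors for it are the multiples of one vector. -/
theorem card_filter_eq_one_of_conj_diagonal [DecidableEq K] (hP : IsUnit P)
    (h : P⁻¹ * M * P = Matrix.diagonal d) {a : K} {w : ι → K} (hw : w ≠ 0)
    (hMw : M.mulVec w = a • w)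
    (huniq : ∀ v, M.mulVec v = a • v → ∃ c : K, v = c • w) :
    (Finset.univ.filter fun i => d i = a).card = 1 := by
  have hdet := (Matrix.isUnit_iff_isUnit_det _).mp hP
  have hMP : M * P = P * Matrix.diagonal d := by
    rw [← h, ← mul_assoc, ← mul_assoc, Matrix.mul_nonsing_inv _ hdet, one_mul]
  set u := P⁻¹.mulVec w with hu
  have hPu : P.mulVec u = w := by
    rw [hu, Matrix.mulVec_mulVec, Matrix.mul_nonsing_inv _ hdet, Matrix.one_mulVec]
  have hdu : (Matrix.diagonal d).mulVec u = a • u := by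
    rw [← h, ← Matrix.mulVec_mulVec, hPu, ← Matrix.mulVec_mulVec, hMw, Matrix.mulVec_smul]
  have hu0 : u ≠ 0 := by
    rintro h0
    rw [h0, Matrix.mulVec_zero] at hPu
    exact hw hPu.symm
  obtain ⟨i₀, hi₀⟩ := Function.ne_iff.mp hu0
  rw [Finset.card_eq_one]
  refine ⟨i₀, ?_⟩
  ext i
  simp only [Finset.mem_filter, Finset.mem_univ, true_and, Finset.mem_singleton]
  constructor
  · intro hi
    by_contra hne
    obtain ⟨c, hc⟩ := huniq (P.mulVec (Pi.single i 1)) (by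
      rw [Matrix.mulVec_mulVec, hMP, ← Matrix.mulVec_mulVec, ← Matrix.mulVec_smul]
      congr 1
      ext j
      by_cases hj : j = i
      · subst hj; simp [hi]
      · simp [hj])
    have h1 : (Pi.single i 1 : ι → K) = c • u := by
      have := congrArg P⁻¹.mulVec hc
      rwa [Matrix.mulVec_mulVec, Matrix.nonsing_inv_mul _ hdet, Matrix.one_mulVec,
        Matrix.mulVec_smul] at this
    have h2 := congrFun h1 i₀
    rw [Pi.single_eq_of_ne (Ne.symm hne), Pi.smul_apply, smul_eq_mul, eq_comm, mul_eq_zero] at h2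
    have hc0 : c = 0 := h2.resolve_right hi₀
    simpa [hc0] using congrFun h1 i
  · rintro rfl
    have := congrFun hdu i
    rw [Matrix.mulVec_diagonal] at this
    exact mul_right_cancel₀ hi₀ this

end Conj

/-! ### Averages over the symmetric group -/

section Averages

variable {n : ℕ} {K : Type*} [Field K]

/-- The sign of `a - b`, as an element of `K`. -/
def sg (K : Type*) [Field K] {n : ℕ} (a b : Fin n) : K :=
  if b < a then 1 else if a < b then -1 else 0

/-- The centred position `2b - (n-1)` of `b`, defined as a sum of signs. -/
def pos (K : Type*) [Field K] {n : ℕ} (b : Fin n) : K := ∑ d, sg K b d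

theorem sg_self (a : Fin n) : sg K a a = 0 := by simp [sg]

theorem sg_swap (a b : Fin n) : sg K b a = -sg K a b := by
  rcases lt_trichotomy a b with h | h | h
  · simp [sg, h, h.not_gt]
  · simp [sg, h]
  · simp [sg, h, h.not_gt]

theorem sg_of_lt {a b : Fin n} (h : a < b) : sg K a b = -1 := by simp [sg, h, h.not_gt]

theorem sum_sg_left (b : Fin n) : ∑ d, sg K d b = -pos K b := by
  simp only [pos, ← Finset.sum_neg_distrib, ← sg_swap]

theorem pos_eq (b : Fin n) : pos K b = 2 * (b.val : K) - ((n : K) - 1) := by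
  have h1 : ∀ d : Fin n, sg K b d = (if d < b then 1 else 0) - (if b < d then 1 else 0) := by
    intro d
    rcases lt_trichotomy b d with h | h | h
    · simp [sg, h, h.not_gt]
    · simp [sg, h]
    · simp [sg, h, h.not_gt]
  have h2 : (Finset.univ.filter fun d => b < d).card + b.val + 1 = n := by
    have : (Finset.univ.filter fun d => b < d) = Finset.Ioi b := by ext; simp
    rw [this, Fin.card_Ioi]
    omega
  have h3 : (Finset.univ.filter fun d => d < b).card = b.val := by
    have : (Finset.univ.filter fun d => d < b) = Finset.Iio b := by ext; simp
    rw [this, Fin.card_Iio]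
  have h4 := congrArg (Nat.cast (R := K)) h2
  push_cast at h4
  simp only [pos, h1, Finset.sum_sub_distrib, Finset.sum_boole, h3]
  linear_combination -h4

/-- If a weight on permutations does not see the positions outside `S`, then the average of
`F (ρ y)` is the same for all `y ∉ S`, and it is found by summing over all these `y`. -/
theorem sum_weight_mul_apply (W : Equiv.Perm (Fin n) → K) (S : Finset (Fin n))
    (hW : ∀ y ∉ S, ∀ y' ∉ S, ∀ ρ, W (ρ * Equiv.swap y y') = W ρ) (F : Fin n → K)
    {y : Fin n} (hy : y ∉ S) :
    ((n : K) - S.card) * ∑ ρ, W ρ * F (ρ y) =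
      ∑ ρ, W ρ * (∑ c, F c - ∑ s ∈ S, F (ρ s)) := by
  have h1 : ∀ y' ∈ Sᶜ, ∑ ρ, W ρ * F (ρ y') = ∑ ρ, W ρ * F (ρ y) := by
    intro y' hy'
    rw [Finset.mem_compl] at hy'
    refine Fintype.sum_equiv (Equiv.mulRight (Equiv.swap y y')) _ _ fun ρ => ?_
    simp [hW y hy y' hy']
  have h2 := Finset.sum_congr rfl h1
  rw [Finset.sum_const, Finset.sum_comm, Finset.card_compl, Fintype.card_fin, nsmul_eq_mul,
    Nat.cast_sub (by simpa using Finset.card_le_univ S)] at h2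
  rw [← h2]
  refine Finset.sum_congr rfl fun ρ _ => ?_
  rw [← Finset.mul_sum, ← Equiv.sum_comp ρ F, ← Finset.sum_add_sum_compl S]
  ring

/-- A weight invariant under exchanging positions `i` and `j` is orthogonal to `sg (ρ i) (ρ j)`. -/
theorem sum_weight_mul_sg_eq_zero [CharZero K] (W : Equiv.Perm (Fin n) → K) {i j : Fin n}
    (hW : ∀ ρ, W (ρ * Equiv.swap i j) = W ρ) :
    ∑ ρ : Equiv.Perm (Fin n), W ρ * sg K (ρ i) (ρ j) = 0 := by
  have h : ∑ ρ : Equiv.Perm (Fin n), W ρ * sg K (ρ i) (ρ j)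
      = -∑ ρ : Equiv.Perm (Fin n), W ρ * sg K (ρ i) (ρ j) := by
    rw [← Finset.sum_neg_distrib]
    refine Fintype.sum_equiv (Equiv.mulRight (Equiv.swap i j)) _ _ fun ρ => ?_
    simp [hW, sg_swap (ρ i) (ρ j)]
  exact self_eq_neg.mp h

theorem cast_factorial_pred (h : 1 ≤ n) : ((n ! : ℕ) : K) = n * ((n - 1)! : ℕ) := by
  rw [← Nat.cast_mul, Nat.mul_factorial_pred (by omega)]

theorem cast_factorial_pred_pred (h : 2 ≤ n) :
    (((n - 1)! : ℕ) : K) = ((n : K) - 1) * ((n - 2)! : ℕ) := by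
  rw [cast_factorial_pred (by omega), Nat.cast_sub (by omega), Nat.sub_sub, Nat.cast_one]

theorem cast_factorial_pred_pred_pred (h : 3 ≤ n) :
    (((n - 2)! : ℕ) : K) = ((n : K) - 2) * ((n - 3)! : ℕ) := by
  rw [cast_factorial_pred (by omega), Nat.cast_sub (by omega), Nat.sub_sub, Nat.cast_ofNat]

variable [CharZero K]

theorem cast_sub_ne_zero {k : ℕ} (h : k < n) : (n : K) - k ≠ 0 := by
  rw [sub_ne_zero]
  exact_mod_cast h.ne'

theorem sum_apply (F : Fin n → K) (y : Fin n) :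
    ∑ ρ : Equiv.Perm (Fin n), F (ρ y) = (n - 1)! * ∑ c, F c := by
  have hn : 0 < n := y.pos
  have h := sum_weight_mul_apply (fun _ => (1 : K)) ∅ (by simp) F (y := y) (by simp)
  simp only [one_mul, Finset.sum_empty, sub_zero, Finset.card_empty, Nat.cast_zero,
    Finset.sum_const, Finset.card_univ, Fintype.card_perm, Fintype.card_fin, nsmul_eq_mul] at h
  rw [cast_factorial_pred hn, mul_assoc] at h
  exact mul_left_cancel₀ (by exact_mod_cast hn.ne') h

theorem sum_inv_apply (F : Fin n → K) (y : Fin n) :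
    ∑ ρ : Equiv.Perm (Fin n), F (ρ⁻¹ y) = (n - 1)! * ∑ c, F c := by
  rw [← sum_apply F y]
  exact Equiv.sum_comp (Equiv.inv (Equiv.Perm (Fin n))) fun ρ => F (ρ y)

theorem sum_indicator (x b : Fin n) :
    ∑ ρ : Equiv.Perm (Fin n), (if ρ x = b then (1 : K) else 0) = (n - 1)! := by
  simpa using sum_apply (fun c => if c = b then (1 : K) else 0) x

theorem sum_indicator_mul_apply (F : Fin n → K) {x y : Fin n} (hxy : y ≠ x) (b : Fin n) :
    ∑ ρ : Equiv.Perm (Fin n), (if ρ x = b then 1 else 0) * F (ρ y)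
      = (n - 2)! * (∑ c, F c - F b) := by
  have hn : 2 ≤ n := by
    have := x.isLt; have := y.isLt; have := Fin.val_ne_of_ne hxy; omega
  have h := sum_weight_mul_apply (fun ρ => if ρ x = b then (1 : K) else 0) {x}
    (by
      intro y hy y' hy' ρ
      rw [Finset.mem_singleton] at hy hy'
      simp [Equiv.swap_apply_of_ne_of_ne (Ne.symm hy) (Ne.symm hy')]) F (y := y) (by simpa using hxy)
  have h2 : ∀ ρ : Equiv.Perm (Fin n),
      (if ρ x = b then (1 : K) else 0) * (∑ c, F c - ∑ s ∈ {x}, F (ρ s))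
        = (if ρ x = b then (1 : K) else 0) * (∑ c, F c - F b) := by
    intro ρ
    split_ifs with h
    · simp [h]
    · simp
  rw [Finset.sum_congr rfl fun ρ _ => h2 ρ, ← Finset.sum_mul, sum_indicator,
    cast_factorial_pred_pred hn, Finset.card_singleton, mul_assoc, Nat.cast_one] at h
  exact mul_left_cancel₀ (by simpa using cast_sub_ne_zero (K := K) (k := 1) hn) h

theorem sum_indicator_pair {x y b c : Fin n} (hxy : x ≠ y) (hbc : b ≠ c) :
    ∑ ρ : Equiv.Perm (Fin n), (if ρ x = b ∧ ρ y = c then (1 : K) else 0) = (n - 2)! := by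
  have := sum_indicator_mul_apply (fun d => if d = c then (1 : K) else 0) hxy.symm b
  simpa [hbc, ← ite_and, and_comm] using this

theorem sum_indicator_pair_mul_apply (F : Fin n → K) {x y u b c : Fin n} (hxy : x ≠ y)
    (hbc : b ≠ c) (hux : u ≠ x) (huy : u ≠ y) :
    ∑ ρ : Equiv.Perm (Fin n), (if ρ x = b ∧ ρ y = c then 1 else 0) * F (ρ u)
      = (n - 3)! * (∑ d, F d - F b - F c) := by
  have hn : 3 ≤ n := by
    have := x.isLt; have := y.isLt; have := u.isLt
    have := Fin.val_ne_of_ne hxy; have := Fin.val_ne_of_ne hux; have := Fin.val_ne_of_ne huy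
    omega
  have h := sum_weight_mul_apply (fun ρ => if ρ x = b ∧ ρ y = c then (1 : K) else 0) {x, y}
    (by
      intro v hv v' hv' ρ
      simp only [Finset.mem_insert, Finset.mem_singleton, not_or] at hv hv'
      simp [Equiv.swap_apply_of_ne_of_ne (Ne.symm hv.1) (Ne.symm hv'.1),
        Equiv.swap_apply_of_ne_of_ne (Ne.symm hv.2) (Ne.symm hv'.2)]) F (y := u)
    (by simp [hux, huy])
  have h2 : ∀ ρ : Equiv.Perm (Fin n),
      (if ρ x = b ∧ ρ y = c then (1 : K) else 0) * (∑ c, F c - ∑ s ∈ {x, y}, F (ρ s))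
        = (if ρ x = b ∧ ρ y = c then (1 : K) else 0) * (∑ d, F d - F b - F c) := by
    intro ρ
    rw [Finset.sum_pair hxy]
    split_ifs with h
    · rw [h.1, h.2]; ring
    · simp
  rw [Finset.sum_congr rfl fun ρ _ => h2 ρ, ← Finset.sum_mul, sum_indicator_pair hxy hbc,
    cast_factorial_pred_pred_pred hn, Finset.card_pair hxy, mul_assoc, Nat.cast_ofNat] at h
  exact mul_left_cancel₀ (by simpa using cast_sub_ne_zero (K := K) (k := 2) hn) h

/-- Only `x = i` and `x = j` contribute: otherwise exchanging positions `i` and `j` flips the sign. -/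
theorem sum_indicator_mul_sg {i j : Fin n} (hij : i ≠ j) (x b : Fin n) :
    ∑ ρ : Equiv.Perm (Fin n), (if ρ x = b then 1 else 0) * sg K (ρ i) (ρ j)
      = (n - 2)! * pos K b * ((if x = i then 1 else 0) - if x = j then 1 else 0) := by
  have key : ∀ i j : Fin n, i ≠ j →
      ∑ ρ : Equiv.Perm (Fin n), (if ρ i = b then 1 else 0) * sg K (ρ i) (ρ j)
        = (n - 2)! * pos K b := by
    intro i j hij
    have h := sum_indicator_mul_apply (fun d => sg K b d) hij.symm b
    rw [sg_self, sub_zero] at h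
    rw [pos, ← h]
    refine Finset.sum_congr rfl fun ρ _ => ?_
    split_ifs with h
    · rw [h]
    · simp
  by_cases hi : x = i
  · subst hi
    rw [key x j hij]
    simp [hij]
  by_cases hj : x = j
  · subst hj
    simp_rw [fun ρ : Equiv.Perm (Fin n) => sg_swap (K := K) (ρ x) (ρ i), mul_neg,
      Finset.sum_neg_distrib]
    rw [key x i hij.symm]
    simp [hij.symm]
  · rw [sum_weight_mul_sg_eq_zero]
    · simp [hi, hj]
    · intro ρ
      simp [Equiv.swap_apply_of_ne_of_ne hi hj]

theorem sum_sg_mul_inv_apply {i j : Fin n} (hij : i ≠ j) (g : Fin n → K) (b : Fin n) :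
    ∑ ρ : Equiv.Perm (Fin n), sg K (ρ i) (ρ j) * g (ρ⁻¹ b)
      = (n - 2)! * pos K b * (g i - g j) := by
  have h1 : ∀ ρ : Equiv.Perm (Fin n),
      g (ρ⁻¹ b) = ∑ x, g x * (if ρ x = b then 1 else 0) := by
    intro ρ
    have : ∀ x, ρ x = b ↔ x = ρ⁻¹ b := fun x => by rw [Equiv.Perm.eq_inv_iff_eq]
    simp [this]
  have h2 : ∑ ρ : Equiv.Perm (Fin n), sg K (ρ i) (ρ j) * g (ρ⁻¹ b)
      = ∑ x, g x * ∑ ρ : Equiv.Perm (Fin n), (if ρ x = b then 1 else 0) * sg K (ρ i) (ρ j) := by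
    simp_rw [h1, Finset.mul_sum]
    rw [Finset.sum_comm]
    refine Finset.sum_congr rfl fun x _ => Finset.sum_congr rfl fun ρ _ => ?_
    ring
  rw [h2]
  simp_rw [sum_indicator_mul_sg hij]
  have h3 : ∀ x, g x * ((n - 2)! * pos K b * ((if x = i then 1 else 0) - if x = j then 1 else 0))
      = (n - 2)! * pos K b * (g x * (if x = i then 1 else 0) - g x * if x = j then 1 else 0) := by
    intro x; ring
  simp_rw [h3, ← Finset.mul_sum, Finset.sum_sub_distrib]
  simp

theorem sum_fixed_mul_inv_apply (g : Fin n → K) (b : Fin n) (hn : 2 ≤ n) :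
    ∑ ρ : Equiv.Perm (Fin n), (∑ m, if ρ m = m then 1 else 0) * g (ρ⁻¹ b)
      = (n - 2)! * n * g b + (n - 2)! * (n - 2) * ∑ c, g c := by
  have h1 : ∑ ρ : Equiv.Perm (Fin n), (∑ m, if ρ m = m then 1 else 0) * g (ρ⁻¹ b)
      = ∑ m, ∑ ρ : Equiv.Perm (Fin n), (if ρ m = m then 1 else 0) * g (ρ b) := by
    simp_rw [Finset.sum_mul]
    rw [Finset.sum_comm]
    refine Finset.sum_congr rfl fun m _ => ?_
    rw [← Equiv.sum_comp (Equiv.inv (Equiv.Perm (Fin n)))]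
    refine Finset.sum_congr rfl fun ρ _ => ?_
    simp [Equiv.symm_apply_eq, eq_comm (a := m)]
  have h2 : ∀ m, ∑ ρ : Equiv.Perm (Fin n), (if ρ m = m then 1 else 0) * g (ρ b)
      = (n - 2)! * (∑ c, g c - g m)
        + if m = b then (n - 1)! * g b - (n - 2)! * (∑ c, g c - g b) else 0 := by
    intro m
    split_ifs with h
    · subst h
      rw [← sum_indicator m m, Finset.sum_mul, add_sub_cancel]
      refine Finset.sum_congr rfl fun ρ _ => ?_
      split_ifs with h
      · rw [h]
      · simp
    · rw [sum_indicator_mul_apply g (Ne.symm h), add_zero]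
  rw [h1, Finset.sum_congr rfl fun m _ => h2 m, Finset.sum_add_distrib, ← Finset.mul_sum,
    Finset.sum_sub_distrib, Finset.sum_ite_eq' Finset.univ b, cast_factorial_pred_pred hn]
  simp
  ring

theorem sum_fixed_mul_sg {b c : Fin n} (hbc : b ≠ c) :
    ∑ ρ : Equiv.Perm (Fin n), (∑ m, if ρ m = m then 1 else 0) * sg K (ρ⁻¹ b) (ρ⁻¹ c)
      = (n - 2)! * (pos K b - pos K c) := by
  have h1 : ∑ ρ : Equiv.Perm (Fin n), (∑ m, if ρ m = m then 1 else 0) * sg K (ρ⁻¹ b) (ρ⁻¹ c)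
      = ∑ m, ∑ ρ : Equiv.Perm (Fin n), (if ρ m = m then 1 else 0) * sg K (ρ b) (ρ c) := by
    simp_rw [Finset.sum_mul]
    rw [Finset.sum_comm]
    refine Finset.sum_congr rfl fun m _ => ?_
    rw [← Equiv.sum_comp (Equiv.inv (Equiv.Perm (Fin n)))]
    refine Finset.sum_congr rfl fun ρ _ => ?_
    simp [Equiv.symm_apply_eq, eq_comm (a := m)]
  simp_rw [h1, sum_indicator_mul_sg hbc, mul_sub, Finset.sum_sub_distrib]
  simp

/-- The average of `sg (ρ i) (ρ j)` over the permutations with two prescribed values. It vanishes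
unless `{x, y}` meets `{i, j}`; the three terms are for two common positions, for `x` as the only
one, and for `y` as the only one. -/
theorem sum_indicator_pair_mul_sg {i j x y b c : Fin n} (hij : i ≠ j) (hxy : x ≠ y) (hbc : b ≠ c) :
    ∑ ρ : Equiv.Perm (Fin n), (if ρ x = b ∧ ρ y = c then 1 else 0) * sg K (ρ i) (ρ j)
      = (n - 2)! * sg K b c * ((if x = i then 1 else 0) * (if y = j then 1 else 0)
            - (if x = j then 1 else 0) * (if y = i then 1 else 0))
        + (n - 3)! * (pos K b - sg K b c) *
          ((if x = i then 1 else 0) * (1 - if y = j then 1 else 0)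
            - (if x = j then 1 else 0) * (1 - if y = i then 1 else 0))
        + (n - 3)! * (pos K c + sg K b c) *
          ((if y = i then 1 else 0) * (1 - if x = j then 1 else 0)
            - (if y = j then 1 else 0) * (1 - if x = i then 1 else 0)) := by
  have both : ∀ x y : Fin n, x ≠ y →
      ∑ ρ : Equiv.Perm (Fin n), (if ρ x = b ∧ ρ y = c then 1 else 0) * sg K (ρ x) (ρ y)
        = (n - 2)! * sg K b c := by
    intro x y hxy
    rw [← sum_indicator_pair hxy hbc, Finset.sum_mul]
    refine Finset.sum_congr rfl fun ρ _ => ?_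
    split_ifs with h
    · rw [h.1, h.2]
    · simp
  have left : ∀ x y u : Fin n, x ≠ y → u ≠ x → u ≠ y →
      ∑ ρ : Equiv.Perm (Fin n), (if ρ x = b ∧ ρ y = c then 1 else 0) * sg K (ρ x) (ρ u)
        = (n - 3)! * (pos K b - sg K b c) := by
    intro x y u hxy hux huy
    have h := sum_indicator_pair_mul_apply (fun d => sg K b d) hxy hbc hux huy
    rw [sg_self, sub_zero] at h
    rw [pos, ← h]
    refine Finset.sum_congr rfl fun ρ _ => ?_
    split_ifs with h
    · rw [h.1]
    · simp
  have right : ∀ x y u : Fin n, x ≠ y → u ≠ x → u ≠ y →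
      ∑ ρ : Equiv.Perm (Fin n), (if ρ x = b ∧ ρ y = c then 1 else 0) * sg K (ρ y) (ρ u)
        = (n - 3)! * (pos K c + sg K b c) := by
    intro x y u hxy hux huy
    have h := sum_indicator_pair_mul_apply (fun d => sg K c d) hxy hbc hux huy
    rw [sg_self, sub_zero, sg_swap b c, sub_neg_eq_add] at h
    rw [pos, ← h]
    refine Finset.sum_congr rfl fun ρ _ => ?_
    split_ifs with h
    · rw [h.2]
    · simp
  -- Both sides are antisymmetric in `i` and `j`, so half of the cases suffice.
  have flip : ∀ u v : Fin n,
      ∑ ρ : Equiv.Perm (Fin n), (if ρ x = b ∧ ρ y = c then 1 else 0) * sg K (ρ u) (ρ v)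
      = -∑ ρ : Equiv.Perm (Fin n), (if ρ x = b ∧ ρ y = c then 1 else 0) * sg K (ρ v) (ρ u) := by
    intro u v
    rw [← Finset.sum_neg_distrib]
    refine Finset.sum_congr rfl fun ρ _ => ?_
    rw [sg_swap (ρ v) (ρ u), mul_neg]
  by_cases hxi : x = i
  · subst hxi
    by_cases hyj : y = j
    · subst hyj
      rw [both x y hxy]
      simp [hxy, hxy.symm]
    · rw [left x y j hxy hij.symm (Ne.symm hyj)]
      simp [hij, hxy.symm, hyj]
  by_cases hxj : x = j
  · subst hxj
    rw [flip]
    by_cases hyi : y = i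
    · subst hyi
      rw [both x y hxy]
      simp [hxy, hxy.symm]
    · rw [left x y i hxy hij (Ne.symm hyi)]
      simp [hij.symm, hxy.symm, hyi]
  by_cases hyi : y = i
  · subst hyi
    rw [right x y j hxy (Ne.symm hxj) hij.symm]
    simp [hxi, hxj, hij]
  by_cases hyj : y = j
  · subst hyj
    rw [flip]
    rw [right x y i hxy (Ne.symm hxi) hij]
    simp [hxi, hxj, hij.symm]
  · rw [sum_weight_mul_sg_eq_zero]
    · simp [hxi, hxj, hyi, hyj]
    · intro ρ
      simp [Equiv.swap_apply_of_ne_of_ne hxi hxj, Equiv.swap_apply_of_ne_of_ne hyi hyj]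

theorem sum_sg_mul_sg {i j b c : Fin n} (hij : i ≠ j) (hbc : b ≠ c) :
    ∑ ρ : Equiv.Perm (Fin n), sg K (ρ i) (ρ j) * sg K (ρ⁻¹ b) (ρ⁻¹ c)
      = 2 * (n - 2)! * sg K i j * sg K b c
        + (n - 3)! * (pos K i - pos K j - 2 * sg K i j) * (pos K b - pos K c - 2 * sg K b c) := by
  have h1 : ∀ ρ : Equiv.Perm (Fin n), sg K (ρ⁻¹ b) (ρ⁻¹ c)
      = ∑ x, ∑ y, sg K x y * (if ρ x = b ∧ ρ y = c then 1 else 0) := by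
    intro ρ
    have : ∀ x b, ρ x = b ↔ x = ρ⁻¹ b := fun x b => by rw [Equiv.Perm.eq_inv_iff_eq]
    simp [this, ite_and]
  have h2 : ∑ ρ : Equiv.Perm (Fin n), sg K (ρ i) (ρ j) * sg K (ρ⁻¹ b) (ρ⁻¹ c)
      = ∑ x, ∑ y, sg K x y *
        ∑ ρ : Equiv.Perm (Fin n), (if ρ x = b ∧ ρ y = c then 1 else 0) * sg K (ρ i) (ρ j) := by
    simp_rw [h1, Finset.mul_sum]
    rw [Finset.sum_comm]
    refine Finset.sum_congr rfl fun x _ => ?_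
    rw [Finset.sum_comm]
    refine Finset.sum_congr rfl fun y _ => Finset.sum_congr rfl fun ρ _ => ?_
    ring
  rw [h2]
  set A : K := (n - 2)! * sg K b c with hA
  set B : K := (n - 3)! * (pos K b - sg K b c) with hB
  set D : K := (n - 3)! * (pos K c + sg K b c) with hD
  have h3 : ∀ x y, sg K x y *
      ∑ ρ : Equiv.Perm (Fin n), (if ρ x = b ∧ ρ y = c then 1 else 0) * sg K (ρ i) (ρ j)
      = (A - B - D) * ((if x = i then if y = j then sg K x y else 0 else 0)
          - (if x = j then if y = i then sg K x y else 0 else 0))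
        + B * ((if x = i then sg K x y else 0) - (if x = j then sg K x y else 0))
        + D * ((if y = i then sg K x y else 0) - (if y = j then sg K x y else 0))
        + 2 * D * ((if x = i then if y = j then sg K x y else 0 else 0)
          - (if x = j then if y = i then sg K x y else 0 else 0)) := by
    intro x y
    by_cases hxy : x = y
    · subst hxy
      simp [sg_self]
    · rw [sum_indicator_pair_mul_sg hij hxy hbc, ← hA, ← hB, ← hD]
      split_ifs <;> ring
  simp_rw [h3, Finset.sum_add_distrib, ← Finset.mul_sum, Finset.sum_sub_distrib]
  simp [sum_sg_left, sg_swap i j]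
  rw [hA, hB, hD, ← pos, ← pos]
  ring

end Averages

/-! ### Convolution by the statistic -/

section Operator

variable {n : ℕ} {K : Type*} [Field K]

/-- The statistic `inv_y + fix_z` with weights `Y i j` and `Z` in a field `K`. An inversion
indicator is written as `(1 + sg (ρ i) (ρ j)) / 2`. -/
def stat (Y : Fin n → Fin n → K) (Z : K) (ρ : Equiv.Perm (Fin n)) : K :=
  ∑ p ∈ pairs n, Y p.1 p.2 * ((1 + sg K (ρ p.1) (ρ p.2)) / 2)
    + Z * ∑ m, if ρ m = m then 1 else 0

/-- The matrix of the statistic `stat` over the group. -/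
def statMatrix (Y : Fin n → Fin n → K) (Z : K) :
    Matrix (Equiv.Perm (Fin n)) (Equiv.Perm (Fin n)) K :=
  Matrix.of fun σ τ => stat Y Z (σ * τ⁻¹)

/-- The eigenvalue of `statMatrix` on the constant functions. -/
def eig₁ (Y : Fin n → Fin n → K) (Z : K) : K :=
  (n ! : K) / 2 * ∑ p ∈ pairs n, Y p.1 p.2 + (n ! : K) * Z

/-- The eigenvalue of `statMatrix` at `σ ↦ pos (σ k)`, modulo constants. -/
def eig₂ (Y : Fin n → Fin n → K) (Z : K) : K :=
  ((n - 2)! : K) * n * Z -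
    ((n - 2)! : K) * ∑ p ∈ pairs n, ((p.2.val : K) - (p.1.val : K)) * Y p.1 p.2

/-- The eigenvalue of `statMatrix` at `σ ↦ sg (σ k) (σ l)`, modulo functions of one position. -/
def eig₃ (Y : Fin n → Fin n → K) : K :=
  -(((n - 3)! : K) *
    ∑ p ∈ pairs n, ((n : K) - 2 * ((p.2.val : K) - (p.1.val : K))) * Y p.1 p.2)

/-- The eigenvalue of `statMatrix` on functions of one position, modulo constants and `pos`. -/
def eig₄ (n : ℕ) (Z : K) : K := ((n - 2)! : K) * n * Z

theorem statMatrix_mulVec (Y : Fin n → Fin n → K) (Z : K) (v : Equiv.Perm (Fin n) → K)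
    (σ : Equiv.Perm (Fin n)) :
    (statMatrix Y Z).mulVec v σ = ∑ ρ, stat Y Z ρ * v (ρ⁻¹ * σ) := by
  rw [Matrix.mulVec, dotProduct]
  refine Fintype.sum_equiv ((Equiv.inv _).trans (Equiv.mulLeft σ)) _ _ fun τ => ?_
  simp [statMatrix]

theorem sum_stat_mul (Y : Fin n → Fin n → K) (Z : K) (F : Equiv.Perm (Fin n) → K) :
    ∑ ρ, stat Y Z ρ * F ρ =
      ∑ p ∈ pairs n, Y p.1 p.2 * ((∑ ρ, F ρ + ∑ ρ, sg K (ρ p.1) (ρ p.2) * F ρ) / 2)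
        + Z * ∑ ρ : Equiv.Perm (Fin n), (∑ m, if ρ m = m then 1 else 0) * F ρ := by
  simp_rw [stat, add_mul, Finset.sum_add_distrib, Finset.sum_mul]
  congr 1
  · rw [Finset.sum_comm]
    refine Finset.sum_congr rfl fun p _ => ?_
    rw [← Finset.sum_add_distrib, Finset.sum_div, Finset.mul_sum]
    refine Finset.sum_congr rfl fun ρ _ => ?_
    ring
  · rw [Finset.mul_sum]
    refine Finset.sum_congr rfl fun ρ _ => ?_
    rw [mul_assoc, Finset.sum_mul]

theorem ne_of_mem_pairs {p : Fin n × Fin n} (hp : p ∈ pairs n) : p.1 ≠ p.2 :=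
  (Finset.mem_filter.mp hp).2.ne

theorem trace_statMatrix (Y : Fin n → Fin n → K) (Z : K) :
    (statMatrix Y Z).trace = (n ! : K) * n * Z := by
  have h : stat Y Z 1 = n * Z := by
    rw [stat, Finset.sum_eq_zero]
    · simp [mul_comm]
    · intro p hp
      simp [sg_of_lt (Finset.mem_filter.mp hp).2]
  simp [Matrix.trace, statMatrix, h, Fintype.card_perm, mul_assoc]

variable [CharZero K]

/-- Convolution by `stat` on functions of one position: a multiple of the identity, plus an operator
with values in the span of `1` and `pos`. -/
theorem sum_stat_mul_inv_apply (Y : Fin n → Fin n → K) (Z : K) (hn : 2 ≤ n) (g : Fin n → K)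
    (b : Fin n) :
    ∑ ρ, stat Y Z ρ * g (ρ⁻¹ b) =
      eig₄ n Z * g b
        + ((n - 1)! / 2 * ∑ p ∈ pairs n, Y p.1 p.2 + Z * ((n - 2)! * (n - 2))) * ∑ c, g c
        + ((n - 2)! / 2 * ∑ p ∈ pairs n, Y p.1 p.2 * (g p.1 - g p.2)) * pos K b := by
  rw [sum_stat_mul, sum_fixed_mul_inv_apply g b hn, sum_inv_apply]
  have h : ∀ p ∈ pairs n, Y p.1 p.2 * (((n - 1)! * ∑ c, g c
      + ∑ ρ : Equiv.Perm (Fin n), sg K (ρ p.1) (ρ p.2) * g (ρ⁻¹ b)) / 2)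
      = (n - 1)! / 2 * (∑ c, g c) * Y p.1 p.2
        + (n - 2)! / 2 * pos K b * (Y p.1 p.2 * (g p.1 - g p.2)) := by
    intro p hp
    rw [sum_sg_mul_inv_apply (ne_of_mem_pairs hp)]
    ring
  rw [Finset.sum_congr rfl h, Finset.sum_add_distrib, ← Finset.mul_sum, ← Finset.mul_sum, eig₄]
  ring

theorem sum_stat (Y : Fin n → Fin n → K) (Z : K) (hn : 2 ≤ n) :
    ∑ ρ, stat Y Z ρ = eig₁ Y Z := by
  have h := sum_stat_mul_inv_apply Y Z hn (fun _ => 1) ⟨0, by omega⟩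
  simp only [mul_one, sub_self, mul_zero, Finset.sum_const_zero, zero_mul, add_zero,
    Finset.sum_const, Finset.card_univ, Fintype.card_fin, nsmul_eq_mul] at h
  rw [h, eig₁, eig₄, cast_factorial_pred (n := n) (by omega), cast_factorial_pred_pred hn]
  ring

theorem sum_pos : ∑ c : Fin n, pos K c = 0 := by
  have h : ∑ c : Fin n, pos K c = -∑ c : Fin n, pos K c := by
    rw [← Finset.sum_neg_distrib, ← Finset.sum_congr rfl fun b _ => sum_sg_left (K := K) b]
    simp_rw [pos]
    exact Finset.sum_comm
  exact self_eq_neg.mp h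

theorem sum_stat_mul_pos (Y : Fin n → Fin n → K) (Z : K) (hn : 2 ≤ n) (b : Fin n) :
    ∑ ρ, stat Y Z ρ * pos K (ρ⁻¹ b) = eig₂ Y Z * pos K b := by
  have h : ∀ p ∈ pairs n, Y p.1 p.2 * (pos K p.1 - pos K p.2)
      = -2 * (((p.2.val : K) - (p.1.val : K)) * Y p.1 p.2) := by
    intro p _
    rw [pos_eq, pos_eq]
    ring
  rw [sum_stat_mul_inv_apply Y Z hn, sum_pos, Finset.sum_congr rfl h, ← Finset.mul_sum, eig₂, eig₄]
  ring

theorem sum_stat_mul_sg (Y : Fin n → Fin n → K) (Z : K) (hn : 3 ≤ n) :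
    ∃ κ, ∀ b c : Fin n, b ≠ c → ∑ ρ, stat Y Z ρ * sg K (ρ⁻¹ b) (ρ⁻¹ c)
      = eig₃ Y * sg K b c + κ * (pos K b - pos K c) := by
  refine ⟨∑ p ∈ pairs n, Y p.1 p.2 * ((n - 3)! / 2 * (pos K p.1 - pos K p.2 + 2))
    + Z * (n - 2)!, fun b c hbc => ?_⟩
  have h0 : ∑ ρ : Equiv.Perm (Fin n), sg K (ρ⁻¹ b) (ρ⁻¹ c) = 0 := by
    rw [← sum_weight_mul_sg_eq_zero (K := K) (fun _ => 1) (i := b) (j := c) (fun _ => rfl)]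
    simp_rw [one_mul]
    exact Equiv.sum_comp (Equiv.inv (Equiv.Perm (Fin n))) fun ρ => sg K (ρ b) (ρ c)
  have h : ∀ p ∈ pairs n, Y p.1 p.2 *
      ((0 + ∑ ρ : Equiv.Perm (Fin n), sg K (ρ p.1) (ρ p.2) * sg K (ρ⁻¹ b) (ρ⁻¹ c)) / 2)
      = -((n - 3)! * sg K b c) * (((n : K) - 2 * ((p.2.val : K) - (p.1.val : K))) * Y p.1 p.2)
        + (pos K b - pos K c) * (Y p.1 p.2 * ((n - 3)! / 2 * (pos K p.1 - pos K p.2 + 2))) := by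
    intro p hp
    rw [sum_sg_mul_sg (ne_of_mem_pairs hp) hbc, sg_of_lt (Finset.mem_filter.mp hp).2,
      cast_factorial_pred_pred_pred hn, pos_eq p.1, pos_eq p.2]
    ring
  rw [sum_stat_mul, h0, sum_fixed_mul_sg hbc, Finset.sum_congr rfl h, Finset.sum_add_distrib,
    ← Finset.mul_sum, ← Finset.mul_sum, eig₃]
  ring

end Operator

/-! ### The invariant flag -/

section Flag

variable {n : ℕ} {K : Type*} [Field K]

theorem statMatrix_mulVec_one [CharZero K] (Y : Fin n → Fin n → K) (Z : K) (hn : 2 ≤ n) :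
    (statMatrix Y Z).mulVec 1 = eig₁ Y Z • 1 := by
  ext σ
  rw [statMatrix_mulVec]
  simpa using sum_stat Y Z hn

/-- The line of constant functions. -/
def flag₀ (n : ℕ) (K : Type*) [Field K] : Submodule K (Equiv.Perm (Fin n) → K) :=
  Submodule.span K {1}

/-- The vectors that `statMatrix - eig₂` sends to constants. -/
def flag₁ (Y : Fin n → Fin n → K) (Z : K) : Submodule K (Equiv.Perm (Fin n) → K) :=
  (flag₀ n K).comap ((statMatrix Y Z).mulVecLin - algebraMap K _ (eig₂ Y Z))

/-- The vectors that `statMatrix - eig₄` sends to `flag₁`. -/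
def flag₂ (Y : Fin n → Fin n → K) (Z : K) : Submodule K (Equiv.Perm (Fin n) → K) :=
  (flag₁ Y Z).comap ((statMatrix Y Z).mulVecLin - algebraMap K _ (eig₄ n Z))

/-- The vectors that `statMatrix - eig₃` sends to `flag₂`. -/
def flag₃ (Y : Fin n → Fin n → K) (Z : K) : Submodule K (Equiv.Perm (Fin n) → K) :=
  (flag₂ Y Z).comap ((statMatrix Y Z).mulVecLin - algebraMap K _ (eig₃ Y))

theorem mem_flag₁ {Y : Fin n → Fin n → K} {Z : K} {v : Equiv.Perm (Fin n) → K} :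
    v ∈ flag₁ Y Z ↔ (statMatrix Y Z).mulVec v - eig₂ Y Z • v ∈ flag₀ n K := Iff.rfl

theorem mem_flag₂ {Y : Fin n → Fin n → K} {Z : K} {v : Equiv.Perm (Fin n) → K} :
    v ∈ flag₂ Y Z ↔ (statMatrix Y Z).mulVec v - eig₄ n Z • v ∈ flag₁ Y Z := Iff.rfl

theorem mem_flag₃ {Y : Fin n → Fin n → K} {Z : K} {v : Equiv.Perm (Fin n) → K} :
    v ∈ flag₃ Y Z ↔ (statMatrix Y Z).mulVec v - eig₃ Y • v ∈ flag₂ Y Z := Iff.rfl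

theorem one_mem_flag₀ : (1 : Equiv.Perm (Fin n) → K) ∈ flag₀ n K :=
  Submodule.mem_span_singleton_self 1

variable [CharZero K] (Y : Fin n → Fin n → K) (Z : K)

theorem one_mem_flag₁ (hn : 2 ≤ n) : (1 : Equiv.Perm (Fin n) → K) ∈ flag₁ Y Z := by
  rw [mem_flag₁, statMatrix_mulVec_one Y Z hn, ← sub_smul]
  exact Submodule.smul_mem _ _ one_mem_flag₀

theorem pos_mem_flag₁ (hn : 2 ≤ n) (k : Fin n) : (fun σ => pos K (σ k)) ∈ flag₁ Y Z := by
  have h : (statMatrix Y Z).mulVec (fun σ => pos K (σ k)) = eig₂ Y Z • fun σ => pos K (σ k) := by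
    ext σ
    rw [statMatrix_mulVec]
    simpa using sum_stat_mul_pos Y Z hn (σ k)
  rw [mem_flag₁, h, sub_self]
  exact Submodule.zero_mem _

/-- Functions of one position lie in `flag₂`. -/
theorem apply_mem_flag₂ (hn : 2 ≤ n) (g : Fin n → K) (k : Fin n) :
    (fun σ => g (σ k)) ∈ flag₂ Y Z := by
  obtain ⟨c, d, hcd⟩ : ∃ c d : K, ∀ b, ∑ ρ, stat Y Z ρ * g (ρ⁻¹ b)
      = eig₄ n Z * g b + c + d * pos K b := ⟨_, _, sum_stat_mul_inv_apply Y Z hn g⟩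
  have h : (statMatrix Y Z).mulVec (fun σ => g (σ k))
      = eig₄ n Z • (fun σ => g (σ k)) + c • 1 + d • fun σ => pos K (σ k) := by
    ext σ
    rw [statMatrix_mulVec]
    simpa using hcd (σ k)
  rw [mem_flag₂, h, add_assoc, add_sub_cancel_left]
  exact Submodule.add_mem _ (Submodule.smul_mem _ _ (one_mem_flag₁ Y Z hn))
    (Submodule.smul_mem _ _ (pos_mem_flag₁ Y Z hn k))

theorem apply_mem_flag₃ (hn : 2 ≤ n) (g : Fin n → K) (k : Fin n) :
    (fun σ => g (σ k)) ∈ flag₃ Y Z := by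
  -- The image of a function of `σ k` is again a function of `σ k`.
  have h : ∃ g' : Fin n → K, (statMatrix Y Z).mulVec (fun σ => g (σ k)) = fun σ => g' (σ k) :=
    ⟨fun b => ∑ ρ, stat Y Z ρ * g (ρ⁻¹ b), funext fun σ => by simp [statMatrix_mulVec]⟩
  obtain ⟨g', h⟩ := h
  rw [mem_flag₃, h]
  exact Submodule.sub_mem _ (apply_mem_flag₂ Y Z hn g' k)
    (Submodule.smul_mem _ _ (apply_mem_flag₂ Y Z hn g k))

theorem sg_mem_flag₃ (hn : 3 ≤ n) {k l : Fin n} (hkl : k ≠ l) :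
    (fun σ => sg K (σ k) (σ l)) ∈ flag₃ Y Z := by
  obtain ⟨κ, hκ⟩ := sum_stat_mul_sg Y Z hn
  have h : (statMatrix Y Z).mulVec (fun σ => sg K (σ k) (σ l))
      = eig₃ Y • (fun σ => sg K (σ k) (σ l))
        + κ • ((fun σ => pos K (σ k)) - fun σ => pos K (σ l)) := by
    ext σ
    rw [statMatrix_mulVec]
    simpa using hκ (σ k) (σ l) (σ.injective.ne hkl)
  rw [mem_flag₃, h, add_sub_cancel_left]
  exact Submodule.smul_mem _ _ (Submodule.sub_mem _ (apply_mem_flag₂ Y Z (by omega) _ k)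
    (apply_mem_flag₂ Y Z (by omega) _ l))

/-- The columns of `statMatrix`, hence all its values, lie in `flag₃`. -/
theorem mulVec_mem_flag₃ (hn : 3 ≤ n) (v : Equiv.Perm (Fin n) → K) :
    (statMatrix Y Z).mulVec v ∈ flag₃ Y Z := by
  have hone : (1 : Equiv.Perm (Fin n) → K) ∈ flag₃ Y Z :=
    apply_mem_flag₃ Y Z (by omega) (fun _ => 1) ⟨0, by omega⟩
  have hcol : ∀ τ : Equiv.Perm (Fin n), (fun σ => stat Y Z (σ * τ⁻¹)) ∈ flag₃ Y Z := by
    intro τ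
    have h : (fun σ => stat Y Z (σ * τ⁻¹)) =
        ∑ p ∈ pairs n, (Y p.1 p.2 / 2) • ((1 : Equiv.Perm (Fin n) → K)
            + fun σ => sg K (σ (τ⁻¹ p.1)) (σ (τ⁻¹ p.2)))
          + Z • ∑ m, fun σ : Equiv.Perm (Fin n) => if σ (τ⁻¹ m) = m then (1 : K) else 0 := by
      ext σ
      simp only [stat, Pi.add_apply, Finset.sum_apply, Pi.smul_apply, smul_eq_mul, Pi.one_apply,
        Equiv.Perm.mul_apply]
      congr 1
      exact Finset.sum_congr rfl fun p _ => by ring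
    rw [h]
    refine Submodule.add_mem _ (Submodule.sum_mem _ fun p hp => Submodule.smul_mem _ _
      (Submodule.add_mem _ hone (sg_mem_flag₃ Y Z hn ?_))) (Submodule.smul_mem _ _
      (Submodule.sum_mem _ fun m _ => ?_))
    · exact (τ⁻¹).injective.ne (ne_of_mem_pairs hp)
    · exact apply_mem_flag₃ Y Z (by omega) (fun c => if c = m then 1 else 0) (τ⁻¹ m)
  have h : (statMatrix Y Z).mulVec v = ∑ τ, v τ • fun σ => stat Y Z (σ * τ⁻¹) := by
    ext σ
    simp [Matrix.mulVec, dotProduct, statMatrix, mul_comm]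
  rw [h]
  exact Submodule.sum_mem _ fun τ _ => Submodule.smul_mem _ _ (hcol τ)

open Polynomial in
/-- The factors bring a vector, from right to left, to `flag₃`, `flag₂`, `flag₁`, the constants
and zero. -/
theorem aeval_statMatrix_eq_zero (hn : 3 ≤ n) :
    aeval (statMatrix Y Z).mulVecLin ((X - C (eig₁ Y Z)) * ((X - C (eig₂ Y Z)) *
      ((X - C (eig₄ n Z)) * ((X - C (eig₃ Y)) * X)))) = 0 := by
  have h₀ : ∀ v ∈ flag₀ n K,
      ((statMatrix Y Z).mulVecLin - algebraMap K _ (eig₁ Y Z)) v = 0 := by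
    intro v hv
    obtain ⟨c, rfl⟩ := Submodule.mem_span_singleton.mp hv
    rw [map_smul]
    simp [statMatrix_mulVec_one Y Z (by omega : 2 ≤ n)]
  refine LinearMap.ext fun v => ?_
  simp only [map_mul, map_sub, aeval_X, aeval_C, Module.End.mul_apply]
  exact h₀ _ (mulVec_mem_flag₃ Y Z hn v)

/-- An eigenvector for `eig₁` is a value of the matrix, hence in `flag₃`; each step down the flag
multiplies it by the difference of `eig₁` and another eigenvalue, so it is constant. -/
theorem exists_eq_smul_one_of_mulVec_eq (hn : 3 ≤ n) (h₂ : eig₁ Y Z ≠ eig₂ Y Z)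
    (h₃ : eig₁ Y Z ≠ eig₃ Y) (h₄ : eig₁ Y Z ≠ eig₄ n Z) (h₅ : eig₁ Y Z ≠ 0)
    (v : Equiv.Perm (Fin n) → K) (hv : (statMatrix Y Z).mulVec v = eig₁ Y Z • v) :
    ∃ c : K, v = c • 1 := by
  have m₃ : v ∈ flag₃ Y Z :=
    (Submodule.smul_mem_iff _ h₅).mp (hv ▸ mulVec_mem_flag₃ Y Z hn v)
  rw [mem_flag₃, hv, ← sub_smul, Submodule.smul_mem_iff _ (sub_ne_zero.mpr h₃), mem_flag₂, hv,
    ← sub_smul, Submodule.smul_mem_iff _ (sub_ne_zero.mpr h₄), mem_flag₁, hv, ← sub_smul,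
    Submodule.smul_mem_iff _ (sub_ne_zero.mpr h₂), flag₀, Submodule.mem_span_singleton] at m₃
  obtain ⟨c, hc⟩ := m₃
  exact ⟨c, hc.symm⟩

end Flag

/-! ### Spectrum with generic weights -/

section Multiplicities

variable {n : ℕ} {K : Type*} [Field K] [CharZero K]

/-- If the five eigenvalues of `statMatrix` are distinct, it is diagonalizable with no further
eigenvalues, `eig₁` is simple, and the multiplicities are tied by the trace and the dimension. -/
theorem statMatrix_diagonalizable (Y : Fin n → Fin n → K) (Z : K) (hn : 3 ≤ n)
    (hnd : [eig₁ Y Z, eig₂ Y Z, eig₃ Y, eig₄ n Z, 0].Nodup) :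
    Diagonalizable (statMatrix Y Z) ∧
    (∀ a, a ∈ spectrum K (statMatrix Y Z) ↔ eigenMult (statMatrix Y Z) a ≠ 0) ∧
    spectrum K (statMatrix Y Z) ⊆ {eig₁ Y Z, eig₂ Y Z, eig₃ Y, eig₄ n Z, 0} ∧
    eigenMult (statMatrix Y Z) (eig₁ Y Z) = 1 ∧
    eig₁ Y Z + eigenMult (statMatrix Y Z) (eig₂ Y Z) * eig₂ Y Z
      + eigenMult (statMatrix Y Z) (eig₃ Y) * eig₃ Y
      + eigenMult (statMatrix Y Z) (eig₄ n Z) * eig₄ n Z = (n ! : K) * n * Z ∧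
    n ! = 1 + (eigenMult (statMatrix Y Z) (eig₂ Y Z) + (eigenMult (statMatrix Y Z) (eig₃ Y)
      + (eigenMult (statMatrix Y Z) (eig₄ n Z) + eigenMult (statMatrix Y Z) 0))) := by
  classical
  have hann := aeval_statMatrix_eq_zero Y Z hn
  have huniq := exists_eq_smul_one_of_mulVec_eq Y Z hn
  have hone := statMatrix_mulVec_one Y Z (by omega : 2 ≤ n)
  have htr := trace_statMatrix Y Z
  generalize eig₁ Y Z = e₁ at *
  generalize eig₂ Y Z = e₂ at *
  generalize eig₃ Y = e₃ at *
  generalize eig₄ n Z = e₄ at *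
  simp only [List.nodup_cons, List.mem_cons, List.not_mem_nil, not_or, or_false, List.nodup_nil,
    not_false_eq_true, and_true] at hnd
  obtain ⟨⟨h12, h13, h14, h10⟩, ⟨h23, h24, h20⟩, ⟨h34, h30⟩, h40⟩ := hnd
  have hprod : ∏ a ∈ ({e₁, e₂, e₃, e₄, 0} : Finset K), (Polynomial.X - Polynomial.C a)
      = (Polynomial.X - Polynomial.C e₁) * ((Polynomial.X - Polynomial.C e₂) *
        ((Polynomial.X - Polynomial.C e₄) * ((Polynomial.X - Polynomial.C e₃) *
          Polynomial.X))) := by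
    rw [Finset.prod_insert (by simp [h12, h13, h14, h10]),
      Finset.prod_insert (by simp [h23, h24, h20]), Finset.prod_insert (by simp [h34, h30]),
      Finset.prod_insert (by simp [h40]), Finset.prod_singleton, map_zero, sub_zero]
    ring
  obtain ⟨P, hP, d, hd, hPd⟩ := exists_conj_diagonal (statMatrix Y Z)
    ({e₁, e₂, e₃, e₄, 0} : Finset K) ⟨e₁, by simp⟩ (by rw [hprod]; exact hann)
  have hsum : ∀ F : K → K,
      ∑ a ∈ ({e₁, e₂, e₃, e₄, 0} : Finset K), F a = F e₁ + (F e₂ + (F e₃ + (F e₄ + F 0))) := by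
    intro F
    rw [Finset.sum_insert (by simp [h12, h13, h14, h10]),
      Finset.sum_insert (by simp [h23, h24, h20]), Finset.sum_insert (by simp [h34, h30]),
      Finset.sum_insert (by simp [h40]), Finset.sum_singleton]
  have hmult := eigenMult_of_conj_diagonal hP hPd
  have hspec := spectrum_of_conj_diagonal hP hPd
  have hm₁ : eigenMult (statMatrix Y Z) e₁ = 1 := by
    rw [hmult]
    exact card_filter_eq_one_of_conj_diagonal hP hPd one_ne_zero hone (huniq h12 h13 h14 h10)
  have hmaps : ∀ i ∈ Finset.univ, d i ∈ ({e₁, e₂, e₃, e₄, 0} : Finset K) := fun i _ => hd i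
  refine ⟨⟨P, hP, d, hPd⟩, fun a => ?_, ?_, hm₁, ?_, ?_⟩
  · rw [hspec, hmult, Finset.card_ne_zero]
    simp [Finset.filter_nonempty_iff]
  · rw [hspec]
    rintro _ ⟨i, rfl⟩
    simpa using hd i
  · rw [trace_of_conj_diagonal hP hPd, ← Finset.sum_fiberwise_of_maps_to hmaps] at htr
    have hfib : ∀ a ∈ ({e₁, e₂, e₃, e₄, 0} : Finset K),
        ∑ i with d i = a, d i = (eigenMult (statMatrix Y Z) a : K) * a := by
      intro a _
      rw [Finset.sum_congr rfl fun i hi => (Finset.mem_filter.mp hi).2, Finset.sum_const,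
        nsmul_eq_mul, hmult]
    rw [Finset.sum_congr rfl hfib, hsum, hm₁] at htr
    rw [← htr]
    push_cast
    ring
  · have h := Finset.card_eq_sum_card_fiberwise (f := d) (s := Finset.univ) hmaps
    rw [Finset.card_univ, Fintype.card_perm, Fintype.card_fin,
      Finset.sum_congr rfl fun a _ => (hmult a).symm, Finset.sum_insert (by simp [h12, h13, h14, h10]),
      Finset.sum_insert (by simp [h23, h24, h20]), Finset.sum_insert (by simp [h34, h30]),
      Finset.sum_insert (by simp [h40]), Finset.sum_singleton, hm₁] at h
    exact h

end Multiplicities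

/-! ### The five eigenvalues as polynomials -/

section Specialization

variable {n : ℕ} {K : Type*} [Field K]

theorem map_ev₁ (f : Poly n →+* K) : f (ev₁ n) = eig₁ (fun i j => f (y i j)) (f z) := by
  have h : ∀ r : ℝ, f (MvPolynomial.C r) = (f.comp MvPolynomial.C) r := fun _ => rfl
  have h2 : (f.comp MvPolynomial.C) 2 = 2 := map_ofNat _ 2
  simp [ev₁, eig₁, h, h2, -RingHom.coe_comp]

theorem map_ev₂ (f : Poly n →+* K) : f (ev₂ n) = eig₂ (fun i j => f (y i j)) (f z) := by
  simp [ev₂, eig₂]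

theorem map_ev₃ (f : Poly n →+* K) : f (ev₃ n) = eig₃ (fun i j => f (y i j)) := by
  have h : ∀ r : ℝ, f (MvPolynomial.C r) = (f.comp MvPolynomial.C) r := fun _ => rfl
  have h2 : (f.comp MvPolynomial.C) 2 = 2 := map_ofNat _ 2
  simp [ev₃, eig₃, h, h2, -RingHom.coe_comp]

theorem map_ev₄ (f : Poly n →+* K) : f (ev₄ n) = eig₄ n (f z) := by
  simp [ev₄, eig₄]

theorem map_invY_add_fixZ [CharZero K] (f : Poly n →+* K) (ρ : Equiv.Perm (Fin n)) :
    f (invY ρ + fixZ ρ) = stat (fun i j => f (y i j)) (f z) ρ := by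
  have h : ∀ p ∈ pairs n, f (y p.1 p.2) * ((1 + sg K (ρ p.1) (ρ p.2)) / 2)
      = if ρ p.1 > ρ p.2 then f (y p.1 p.2) else 0 := by
    intro p hp
    rcases lt_trichotomy (ρ p.1) (ρ p.2) with h | h | h
    · simp [sg, h, h.not_gt]
    · exact absurd (ρ.injective h) (ne_of_mem_pairs hp)
    · simp [sg, h, one_add_one_eq_two]
  rw [map_add, invY, fixZ, stat, Finset.sum_congr rfl h, map_sum, ← Finset.sum_filter]
  congr 1
  · rw [Inv, pairs, Finset.filter_filter]
  · simp [Fix, mul_comm]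

theorem IFfrac_eq_statMatrix (n : ℕ) :
    IFfrac n = statMatrix (fun i j => toFrac n (y i j)) (toFrac n z) := by
  ext σ τ
  exact map_invY_add_fixZ (toFrac n) (σ * τ⁻¹)

/-- Evaluation at the point where `y_{a,b} = t`, `z = u` and the other variables vanish. -/
def evalAt (a b : Fin n) (t u : ℝ) : Poly n →+* ℝ :=
  MvPolynomial.eval (Sum.elim (fun p => if p.1 = (a, b) then t else 0) fun _ => u)

theorem evalAt_z (a b : Fin n) (t u : ℝ) : evalAt a b t u z = u := by
  simp [evalAt, z]

theorem evalAt_y (a b : Fin n) (t u : ℝ) {p : Fin n × Fin n} (hp : p ∈ pairs n) :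
    evalAt a b t u (y p.1 p.2) = if p = (a, b) then t else 0 := by
  simp [evalAt, y, ne_of_mem_pairs hp]

theorem sum_mul_evalAt_y {a b : Fin n} (hab : a < b) (t u : ℝ) (c : Fin n × Fin n → ℝ) :
    ∑ p ∈ pairs n, c p * evalAt a b t u (y p.1 p.2) = c (a, b) * t := by
  rw [Finset.sum_eq_single (a, b)]
  · rw [evalAt_y a b t u (by simp [pairs, hab]), if_pos rfl]
  · intro p hp hne
    rw [evalAt_y a b t u hp, if_neg hne, mul_zero]
  · intro h
    simp [pairs, hab] at h

theorem evalAt_ev₁ {a b : Fin n} (hab : a < b) (t u : ℝ) :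
    evalAt a b t u (ev₁ n) = (n ! : ℝ) / 2 * t + n ! * u := by
  have := sum_mul_evalAt_y hab t u fun _ => 1
  simp only [one_mul] at this
  rw [map_ev₁, eig₁, evalAt_z, this]

theorem evalAt_ev₂ {a b : Fin n} (hab : a < b) (t u : ℝ) :
    evalAt a b t u (ev₂ n) = (n - 2)! * n * u - (n - 2)! * ((b.val - a.val) * t) := by
  rw [map_ev₂, eig₂, evalAt_z,
    sum_mul_evalAt_y hab t u fun p => ((p.2.val : ℝ) - (p.1.val : ℝ))]

theorem evalAt_ev₃ {a b : Fin n} (hab : a < b) (t u : ℝ) :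
    evalAt a b t u (ev₃ n) = -((n - 3)! * ((n - 2 * (b.val - a.val)) * t)) := by
  rw [map_ev₃, eig₃,
    sum_mul_evalAt_y hab t u fun p => ((n : ℝ) - 2 * ((p.2.val : ℝ) - (p.1.val : ℝ)))]

theorem evalAt_ev₄ (a b : Fin n) (t u : ℝ) :
    evalAt a b t u (ev₄ n) = (n - 2)! * n * u := by
  rw [map_ev₄, eig₄, evalAt_z]

/-- The coefficients of `z` and `y_{1,2}` tell the five eigenvalues apart. -/
theorem nodup_eigenvalues (hn : 4 ≤ n) : [ev₁ n, ev₂ n, ev₃ n, ev₄ n, 0].Nodup := by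
  have hab : (⟨0, by omega⟩ : Fin n) < ⟨1, by omega⟩ := by simp
  have hn' : (4 : ℝ) ≤ n := by exact_mod_cast hn
  have hp : (0 : ℝ) < (n - 3)! := by exact_mod_cast Nat.factorial_pos _
  have e2 : ((n - 2)! : ℝ) = (n - 2) * (n - 3)! := cast_factorial_pred_pred_pred (by omega)
  have e1 : (n ! : ℝ) = n * ((n - 1) * ((n - 2) * (n - 3)!)) := by
    rw [cast_factorial_pred (by omega), cast_factorial_pred_pred (by omega), e2]
  have hq : (0 : ℝ) < (n - 2) * (n - 3)! := mul_pos (by linarith) hp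
  have hr : (0 : ℝ) < (n - 2) * (n - 3)! * n := mul_pos hq (by linarith)
  have hz : ∀ {p q : Poly n}, p = q → evalAt (⟨0, by omega⟩ : Fin n) ⟨1, by omega⟩ 0 1 p
      = evalAt (⟨0, by omega⟩ : Fin n) ⟨1, by omega⟩ 0 1 q := fun h => by rw [h]
  have hy : ∀ {p q : Poly n}, p = q → evalAt (⟨0, by omega⟩ : Fin n) ⟨1, by omega⟩ 1 0 p
      = evalAt (⟨0, by omega⟩ : Fin n) ⟨1, by omega⟩ 1 0 q := fun h => by rw [h]
  simp only [List.nodup_cons, List.mem_cons, List.not_mem_nil, not_or, or_false, List.nodup_nil,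
    not_false_eq_true, and_true]
  refine ⟨⟨fun h => ?_, fun h => ?_, fun h => ?_, fun h => ?_⟩,
    ⟨fun h => ?_, fun h => ?_, fun h => ?_⟩, ⟨fun h => ?_, fun h => ?_⟩, fun h => ?_⟩
  · have := hz h
    simp only [evalAt_ev₁ hab, evalAt_ev₂ hab, e1, e2] at this
    nlinarith
  · have := hz h
    simp only [evalAt_ev₁ hab, evalAt_ev₃ hab, e1] at this
    nlinarith
  · have := hz h
    simp only [evalAt_ev₁ hab, evalAt_ev₄, e1, e2] at this
    nlinarith
  · have := hz h
    simp only [evalAt_ev₁ hab, map_zero, e1] at this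
    nlinarith
  · have := hz h
    simp only [evalAt_ev₂ hab, evalAt_ev₃ hab, e2] at this
    nlinarith
  · have := hy h
    simp only [evalAt_ev₂ hab, evalAt_ev₄, e2] at this
    norm_num at this
    exact this.elim (fun h => by linarith) (Nat.factorial_ne_zero _)
  · have := hz h
    simp only [evalAt_ev₂ hab, map_zero, e2] at this
    nlinarith
  · have := hz h
    simp only [evalAt_ev₃ hab, evalAt_ev₄, e2] at this
    nlinarith
  · have := hy h
    simp only [evalAt_ev₃ hab, map_zero] at this
    norm_num at this
    exact this.elim (Nat.factorial_ne_zero _) (fun h => by linarith)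
  · have := hz h
    simp only [evalAt_ev₄, map_zero, e2] at this
    nlinarith

/-- The eigenvalues `ev₁, …, ev₄` satisfy one linear relation, so the trace and the multiplicity
of `ev₁` determine the other multiplicities. -/
theorem multiplicities_of_trace (hn : 4 ≤ n) {m₂ m₃ m₄ : ℕ}
    (h : ev₁ n + (m₂ : Poly n) * ev₂ n + (m₃ : Poly n) * ev₃ n + (m₄ : Poly n) * ev₄ n
      = ((n ! : ℕ) : Poly n) * n * (z : Poly n)) :
    m₂ = n - 1 ∧ m₃ = (n - 1).choose 2 ∧ m₄ = (n - 1) * (n - 2) := by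
  have hab : (⟨0, by omega⟩ : Fin n) < ⟨1, by omega⟩ := by simp
  have hac : (⟨0, by omega⟩ : Fin n) < ⟨2, by omega⟩ := by simp
  have hn' : (4 : ℝ) ≤ n := by exact_mod_cast hn
  have hp : ((n - 3)! : ℝ) ≠ 0 := by exact_mod_cast Nat.factorial_ne_zero _
  have e2 : ((n - 2)! : ℝ) = (n - 2) * (n - 3)! := cast_factorial_pred_pred_pred (by omega)
  have e1 : (n ! : ℝ) = n * ((n - 1) * ((n - 2) * (n - 3)!)) := by
    rw [cast_factorial_pred (by omega), cast_factorial_pred_pred (by omega), e2]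
  have hn2 : (n : ℝ) - 2 ≠ 0 := by linarith
  have hn0 : (n : ℝ) ≠ 0 := by linarith
  have hz := congrArg (evalAt (⟨0, by omega⟩ : Fin n) ⟨1, by omega⟩ 0 1) h
  have hy₁ := congrArg (evalAt (⟨0, by omega⟩ : Fin n) ⟨1, by omega⟩ 1 0) h
  have hy₂ := congrArg (evalAt (⟨0, by omega⟩ : Fin n) ⟨2, by omega⟩ 1 0) h
  simp only [map_add, map_mul, map_natCast, evalAt_ev₁ hab, evalAt_ev₂ hab, evalAt_ev₃ hab,
    evalAt_ev₁ hac, evalAt_ev₂ hac, evalAt_ev₃ hac, evalAt_ev₄, evalAt_z, e1, e2] at hz hy₁ hy₂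
  push_cast at hz hy₁ hy₂
  -- Subtracting the coefficients of `y_{1,2}` and `y_{1,3}` eliminates `ev₁`.
  have r1 : (m₂ : ℝ) * (n - 2) = 2 * m₃ := by
    apply mul_left_cancel₀ hp
    linear_combination hy₁ - hy₂
  have r2 : (n : ℝ) * (n - 1) / 2 = m₂ + m₃ := by
    apply mul_left_cancel₀ hn2
    apply mul_left_cancel₀ hp
    linear_combination hy₁
  have r3 : ((n : ℝ) - 1) + m₂ + m₄ = n * (n - 1) := by
    apply mul_left_cancel₀ hn0
    apply mul_left_cancel₀ hn2
    apply mul_left_cancel₀ hp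
    linear_combination hz
  have s2 : (m₂ : ℝ) = n - 1 := by
    apply mul_left_cancel₀ hn0
    linear_combination r1 - 2 * r2
  have s3 : (m₃ : ℝ) = (n - 1) * (n - 2) / 2 := by rw [s2] at r1; linarith
  have s4 : (m₄ : ℝ) = (n - 1) * (n - 2) := by rw [s2] at r3; linarith
  obtain ⟨k, rfl⟩ : ∃ k, n = k + 2 := ⟨n - 2, by omega⟩
  push_cast at s2 s3 s4
  refine ⟨?_, ?_, ?_⟩
  · have : (m₂ : ℝ) = (k + 1 : ℕ) := by push_cast; linarith
    exact_mod_cast this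
  · have : (m₃ : ℝ) = ((k + 1).choose 2 : ℕ) := by
      rw [Nat.cast_choose_two]
      push_cast
      linear_combination s3
    exact_mod_cast this
  · have : (m₄ : ℝ) = ((k + 1) * k : ℕ) := by
      push_cast
      linear_combination s4
    exact_mod_cast this

end Specialization

end PermStat

open PermStat

theorem theorem1p1 (n : ℕ) (hn : 4 ≤ n) :
    PermStat.Diagonalizable (PermStat.IFfrac n) ∧
    spectrum (PermStat.Frac n) (PermStat.IFfrac n) =
      {PermStat.toFrac n (PermStat.ev₁ n), PermStat.toFrac n (PermStat.ev₂ n),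
        PermStat.toFrac n (PermStat.ev₃ n), PermStat.toFrac n (PermStat.ev₄ n), 0} ∧
    [PermStat.ev₁ n, PermStat.ev₂ n, PermStat.ev₃ n, PermStat.ev₄ n, 0].Nodup ∧
    PermStat.eigenMult (PermStat.IFfrac n) (PermStat.toFrac n (PermStat.ev₁ n)) = 1 ∧
    PermStat.eigenMult (PermStat.IFfrac n) (PermStat.toFrac n (PermStat.ev₂ n)) = n - 1 ∧
    PermStat.eigenMult (PermStat.IFfrac n) (PermStat.toFrac n (PermStat.ev₃ n)) =
      (n - 1).choose 2 ∧
    PermStat.eigenMult (PermStat.IFfrac n) (PermStat.toFrac n (PermStat.ev₄ n)) =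
      (n - 1) * (n - 2) ∧
    (PermStat.eigenMult (PermStat.IFfrac n) 0 : ℚ) =
      (n ! : ℚ) - (n : ℚ) / 2 * (3 * (n : ℚ) - 7) - 3 := by
  have hnd := nodup_eigenvalues hn
  have hinj : Function.Injective (toFrac n) := IsFractionRing.injective _ _
  have : CharZero (Frac n) := charZero_of_injective_algebraMap hinj
  have hnd' := hnd.map hinj
  simp only [List.map_cons, List.map_nil, map_zero, map_ev₁, map_ev₂, map_ev₃, map_ev₄] at hnd'
  obtain ⟨hdiag, hmem, hsub, hm₁, htr, hcard⟩ :=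
    statMatrix_diagonalizable _ _ (by omega : 3 ≤ n) hnd'
  rw [← map_ev₁, ← map_ev₂, ← map_ev₃, ← map_ev₄, ← IFfrac_eq_statMatrix] at *
  have htr' : ev₁ n + (eigenMult (IFfrac n) (toFrac n (ev₂ n)) : Poly n) * ev₂ n
      + (eigenMult (IFfrac n) (toFrac n (ev₃ n)) : Poly n) * ev₃ n
      + (eigenMult (IFfrac n) (toFrac n (ev₄ n)) : Poly n) * ev₄ n
      = ((n ! : ℕ) : Poly n) * n * (z : Poly n) := by
    apply hinj
    simp only [map_add, map_mul, map_natCast]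
    exact htr
  obtain ⟨hm₂, hm₃, hm₄⟩ := multiplicities_of_trace hn htr'
  rw [hm₂, hm₃, hm₄] at hcard
  have hm₀ : (eigenMult (IFfrac n) 0 : ℚ) = (n ! : ℚ) - (n : ℚ) / 2 * (3 * (n : ℚ) - 7) - 3 := by
    rw [hcard]
    obtain ⟨k, rfl⟩ : ∃ k, n = k + 2 := ⟨n - 2, by omega⟩
    simp only [Nat.add_sub_cancel, show k + 2 - 1 = k + 1 by omega]
    push_cast
    rw [Nat.cast_choose_two]
    push_cast
    ring
  have hpos : eigenMult (IFfrac n) 0 ≠ 0 := by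
    intro h0
    have hn' : (4 : ℚ) ≤ n := by exact_mod_cast hn
    have hp : (1 : ℚ) ≤ (n - 3)! := by exact_mod_cast Nat.factorial_pos _
    have hq : (0 : ℚ) ≤ n * ((n - 1) * (n - 2)) :=
      mul_nonneg (by linarith) (mul_nonneg (by linarith) (by linarith))
    rw [h0, cast_factorial_pred (by omega), cast_factorial_pred_pred (by omega),
      cast_factorial_pred_pred_pred (by omega)] at hm₀
    push_cast at hm₀
    -- It remains that `n (n-1) (n-2) > n (3n-7) / 2 + 3`, a cubic inequality in `n - 4 ≥ 0`.
    nlinarith [mul_le_mul_of_nonneg_left hp hq, mul_nonneg (sub_nonneg.mpr hn') (sub_nonneg.mpr hn'),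
      mul_nonneg (mul_nonneg (sub_nonneg.mpr hn') (sub_nonneg.mpr hn')) (sub_nonneg.mpr hn')]
  refine ⟨hdiag, hsub.antisymm ?_, hnd, hm₁, hm₂, hm₃, hm₄, hm₀⟩
  rintro a (rfl | rfl | rfl | rfl | rfl) <;> rw [hmem]
  · rw [hm₁]
    exact one_ne_zero
  · rw [hm₂]
    omega
  · rw [hm₃]
    exact (Nat.choose_pos (by omega)).ne'
  · rw [hm₄]
    exact Nat.mul_ne_zero (by omega) (by omega)
  · exact hpos
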